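/- Let $R$ be an integrally closed Noetherian domain, let $m$ be a positive integer, let $b$ be a nonzero nonunit in $R$, let $p_1,\dots,p_n$ be the distinct prime divisors of $bR$ (that is, the elements of $\operatorname{Ass}(R/bR)$), let $J = p_1\cap\cdots\cap p_n$, and assume that $bR = p_1^{(m)}\cap\cdots\cap p_n^{(m)}$. Here $p^{(k)} = p^kR_p\cap R$ is the $k$-th symbolic power of a prime $p$, and $I_a$ denotes the integral closure in $R$ of an ideal $I$: the set of $x \in R$ with $x^d + a_1x^{d-1}+\cdots+a_d = 0$ for some $d\ge 1$ and $a_i\in I^i$. An ideal $J$ is projectively equivalent to a nonzero proper ideal $I$ if $(I^s)_a = (J^t)_a$ for some positive integers $s,t$. The set of asymptotic prime divisors of an ideal $I$ is $\hat A^*(I) = \{P\in\operatorname{Spec} R \mid P\in\operatorname{Ass}(R/(I^k)_a) \text{ for some positive integer } k\}$. Then each $p_i$ has height one, $J = \operatorname{Rad}(bR)$, and the following statements are equivalent: 1. $J$ is projectively equivalent to $bR$. 2. $J$ is projectively equivalent to some (nonzero proper) principal ideal in $R$. 3. $bR = ((p_1\cap\cdots\cap p_n)^k)_a$ for some positive integer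 $k$. 4. $(J^k)_a$ is principal for some positive integer $k$. 5. $J$ is invertible. 6. $((p_1\cap\cdots\cap p_n)^k)_a = p_1^{(k)}\cap\cdots\cap p_n^{(k)}$ for all positive integers $k$. 7. $\hat A^*(J) = \{p_1,\dots,p_n\}$. 8. $J^kR_U\cap R = (J^k)_a$ for all positive integers $k$, where $U = R\setminus(p_1\cup\cdots\cup p_n)$. -/

import Mathlib

open Polynomial nonZeroDivisors

namespace Ideal

variable {R : Type*} [CommRing R]

/-- `x` is integral over the ideal `I`: it satisfies an equation
`x ^ n + a₁ x ^ (n - 1) + ⋯ + aₙ = 0` with `n ≥ 1` and `aᵢ ∈ I ^ i` for `1 ≤ i ≤ n`. -/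
def IsIntegralElem (I : Ideal R) (x : R) : Prop :=
  ∃ n : ℕ, 0 < n ∧ ∃ a : ℕ → R, (∀ i ∈ Finset.Icc 1 n, a i ∈ I ^ i) ∧
    x ^ n + ∑ i ∈ Finset.Icc 1 n, a i * x ^ (n - i) = 0

/-- `x` is integral over `I` iff `x t` is integral over the Rees algebra `R[It]` (inside `R[t]`);
used here only to see that the elements integral over `I` form an ideal. -/
theorem isIntegralElem_iff (I : Ideal R) (x : R) :
    I.IsIntegralElem x ↔ IsIntegral (reesAlgebra I) (monomial 1 x : R[X]) := by
  constructor
  · rintro ⟨n, hn, a, ha, h⟩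
    classical
    let c : ℕ → reesAlgebra I := fun i =>
      if hi : i ∈ Finset.Icc 1 n then
        ⟨monomial i (a i), reesAlgebra.monomial_mem.mpr (ha i hi)⟩ else 0
    refine ⟨X ^ n + ∑ i ∈ Finset.Icc 1 n, C (c i) * X ^ (n - i), ?_, ?_⟩
    · apply monic_X_pow_add
      refine (degree_sum_le _ _).trans_lt ?_
      refine (Finset.sup_lt_iff (WithBot.bot_lt_coe n)).mpr fun i hi => ?_
      refine (degree_C_mul_X_pow_le _ _).trans_lt ?_
      rw [Finset.mem_Icc] at hi
      exact WithBot.coe_lt_coe.mpr (by omega : n - i < n)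
    · rw [eval₂_add, eval₂_X_pow, eval₂_finsetSum]
      have key : ∀ i ∈ Finset.Icc 1 n,
          eval₂ (algebraMap (reesAlgebra I) R[X]) (monomial 1 x) (C (c i) * X ^ (n - i)) =
            monomial n (a i * x ^ (n - i)) := by
        intro i hi
        have hc : algebraMap (reesAlgebra I) R[X] (c i) = monomial i (a i) := by
          simp only [c, dif_pos hi]; rfl
        rw [eval₂_mul, eval₂_C, eval₂_X_pow, hc, monomial_pow, monomial_mul_monomial]
        rw [Finset.mem_Icc] at hi
        have e : i + 1 * (n - i) = n := by omega
        rw [e]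
      rw [Finset.sum_congr rfl key, monomial_pow, ← map_sum, one_mul, ← map_add, h, map_zero]
  · rintro ⟨p, hp, h⟩
    rcases Nat.eq_zero_or_pos p.natDegree with h0 | hpos
    · rw [hp.natDegree_eq_zero.mp h0, eval₂_one] at h
      have h1 : (1 : R) = 0 := by simpa using congrArg (fun q : R[X] => q.coeff 0) h
      have hs : ∀ y : R, y = 0 := fun y => by rw [← mul_one y, h1, mul_zero]
      exact ⟨1, one_pos, 0, fun i _ => by simp, hs _⟩
    · refine ⟨p.natDegree, hpos, fun i => (p.coeff (p.natDegree - i) : R[X]).coeff i,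
        fun i _ => (p.coeff (p.natDegree - i)).2 i, ?_⟩
      have h' := congrArg (fun q : R[X] => q.coeff p.natDegree) h
      simp only [coeff_zero] at h'
      have key : ∀ j ∈ Finset.range (p.natDegree + 1),
          (algebraMap (reesAlgebra I) R[X] (p.coeff j) * (monomial 1 x) ^ j).coeff p.natDegree =
            (p.coeff j : R[X]).coeff (p.natDegree - j) * x ^ j := by
        intro j hj
        rw [Finset.mem_range] at hj
        rw [monomial_pow, one_mul]
        have : p.natDegree = (p.natDegree - j) + j := by omega
        conv_lhs => rw [this]
        rw [coeff_mul_monomial]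
        rfl
      rw [eval₂_eq_sum_range, finsetSum_coeff, Finset.sum_congr rfl key,
        ← Finset.sum_range_reflect, Finset.sum_range_succ'] at h'
      have e : Finset.Icc 1 p.natDegree = (Finset.range p.natDegree).image (· + 1) := by
        ext i
        simp only [Finset.mem_Icc, Finset.mem_image, Finset.mem_range]
        constructor
        · rintro ⟨h1, h2⟩
          exact ⟨i - 1, by omega, by omega⟩
        · rintro ⟨j, hj, rfl⟩
          omega
      rw [e, Finset.sum_image (by intro a _ b _ hab; simpa using hab), add_comm, ← h']
      congr 1
      · refine Finset.sum_congr rfl fun i hi => ?_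
        rw [Finset.mem_range] at hi
        have e1 : p.natDegree + 1 - 1 - (i + 1) = p.natDegree - (i + 1) := by omega
        have e2 : p.natDegree - (p.natDegree - (i + 1)) = i + 1 := by omega
        rw [e1, e2]
      · simp [hp.coeff_natDegree]

/-- The integral closure `I_a` in `R` of the ideal `I`. -/
def intClosure (I : Ideal R) : Ideal R where
  carrier := {x | I.IsIntegralElem x}
  zero_mem' := by
    rw [Set.mem_ofPred_eq, isIntegralElem_iff, map_zero]
    exact isIntegral_zero
  add_mem' := by
    intro x y hx hy
    rw [Set.mem_ofPred_eq, isIntegralElem_iff] at *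
    rw [map_add]
    exact hx.add hy
  smul_mem' := by
    intro r x hx
    rw [Set.mem_ofPred_eq, isIntegralElem_iff] at *
    rw [smul_eq_mul, ← C_mul_monomial]
    exact (isIntegral_algebraMap (R := reesAlgebra I) (A := R[X])
      (x := algebraMap R (reesAlgebra I) r)).mul hx

/-- `I R_U ∩ R` for a multiplicative set `U` of `R`: the preimage in `R` of the extension of `I`
to the localization of `R` at `U`. -/
def contractLocalization (U : Submonoid R) (I : Ideal R) : Ideal R :=
  (I.map (algebraMap R (Localization U))).comap (algebraMap R (Localization U))

/-- The symbolic power `p ^ (k) = p ^ k R_p ∩ R` of a prime ideal `p`. -/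
def symbolicPow (p : Ideal R) [p.IsPrime] (k : ℕ) : Ideal R :=
  contractLocalization p.primeCompl (p ^ k)

/-- `J` is projectively equivalent to the regular proper ideal `I`: some positive powers of `I`
and `J` have the same integral closure. -/
def IsProjectivelyEquivalent (J I : Ideal R) : Prop :=
  ((∃ x ∈ I, x ∈ R⁰) ∧ I ≠ ⊤) ∧
    ∃ s t : ℕ, 0 < s ∧ 0 < t ∧ (I ^ s).intClosure = (J ^ t).intClosure

/-- The set of asymptotic prime divisors of `I`: the associated primes of `R / (I ^ k)_a`, for all
positive integers `k`. -/
def asymptoticPrimes (I : Ideal R) : Set (Ideal R) :=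
  {P | ∃ k : ℕ, 0 < k ∧ P ∈ associatedPrimes R (R ⧸ (I ^ k).intClosure)}

/-- The ideal `I` of `R` is invertible, as a fractional ideal of the total ring of fractions. -/
def IsInvertible (I : Ideal R) : Prop :=
  IsUnit (I : FractionalIdeal R⁰ (FractionRing R))

end Ideal

/-!
The idea is to measure everything by orders of vanishing along the primes `p i`, and to show that
each of the eight conditions holds exactly when `J ^ m = b R`.

Since `R` is normal and Noetherian and `p i` is associated to `R / b R`, the localization of `R` at
`p i` is a discrete valuation ring (`exists_isLocalUniformizer`). In particular `p i` has height
one, so the `p i` are pairwise incomparable; the symbolic powers of `p i` form the filtration by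
order (`IsLocalUniformizer.mem_of_mul_mem`) and are integrally closed
(`IsLocalUniformizer.intClosure_le`). Hence
`J ^ k ≤ (J ^ k)_a ≤ p_1 ^ (k) ∩ ⋯ ∩ p_n ^ (k)`, and the last ideal is `b ^ l R` when `k = m l`.

* A nonzero principal ideal of a domain has no proper reduction
  (`eq_span_singleton_of_mem_intClosure`). So if `(J ^ k)_a` is principal, then `J ^ k` itself is
  principal and `J` is invertible. As principal ideals are integrally closed, projective
  equivalence of `J` to a principal ideal gives such a `k`.
* If `J` is invertible, write `J ^ m = b L`. The ideal `L` is invertible, contains a power of `b` and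
  lies in no `p i`; therefore `L⁻¹ ≤ R` and `L = R` (`IsInvertible.iInf_pow_eq_span`).
* If `J ^ m = b R` and `x` has order at least `k` at every `p i`, then `x ^ m` lies in
  `b ^ k R = (J ^ k) ^ m`, so `x` is integral over `J ^ k`
  (`intClosure_iInf_pow_of_pow_eq_span`). This is the equality
  `(J ^ k)_a = p_1 ^ (k) ∩ ⋯ ∩ p_n ^ (k)`, and `k = m` gives back `b R = (J ^ m)_a`.

The intersection of the symbolic powers `p i ^ (k)` is the contraction of `J ^ k` from the
localization away from the `p i` (`contractLocalization_iInf_pow`), and it equals `(J ^ k)_a` for all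
`k` exactly when no other primes are asymptotic primes of `J`
(`asymptoticPrimes_iInf_eq_range_iff`).
-/

namespace Ideal

/-! ### Symbolic powers -/

section SymbolicPow

variable {R : Type*} [CommRing R] {p : Ideal R} [p.IsPrime]

theorem mem_contractLocalization {U : Submonoid R} {I : Ideal R} {x : R} :
    x ∈ I.contractLocalization U ↔ ∃ u ∈ U, u * x ∈ I := by
  rw [contractLocalization, mem_comap, IsLocalization.algebraMap_mem_map_algebraMap_iff U]

theorem mem_symbolicPow {k : ℕ} {x : R} :
    x ∈ p.symbolicPow k ↔ ∃ u ∉ p, u * x ∈ p ^ k :=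
  mem_contractLocalization

theorem pow_le_symbolicPow (k : ℕ) : p ^ k ≤ p.symbolicPow k :=
  le_comap_map

theorem symbolicPow_one : p.symbolicPow 1 = p := by
  ext x
  rw [mem_symbolicPow, pow_one]
  exact ⟨fun ⟨u, hu, h⟩ => (IsPrime.mem_or_mem ‹_› h).resolve_left hu,
    fun h => ⟨1, one_notMem p, by rwa [one_mul]⟩⟩

theorem symbolicPow_zero : p.symbolicPow 0 = ⊤ := by
  rw [eq_top_iff, ← Ideal.one_eq_top, ← pow_zero p]
  exact pow_le_symbolicPow 0

theorem symbolicPow_anti {j k : ℕ} (h : j ≤ k) : p.symbolicPow k ≤ p.symbolicPow j :=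
  comap_mono (map_mono (pow_le_pow_right h))

theorem mul_mem_symbolicPow {j k : ℕ} {x y : R} (hx : x ∈ p.symbolicPow j)
    (hy : y ∈ p.symbolicPow k) : x * y ∈ p.symbolicPow (j + k) := by
  obtain ⟨u, hu, hux⟩ := mem_symbolicPow.mp hx
  obtain ⟨v, hv, hvy⟩ := mem_symbolicPow.mp hy
  refine mem_symbolicPow.mpr ⟨u * v, p.primeCompl.mul_mem hu hv, ?_⟩
  rw [pow_add, mul_mul_mul_comm]
  exact mul_mem_mul hux hvy

theorem pow_mem_symbolicPow {j : ℕ} {x : R} (hx : x ∈ p.symbolicPow j) (n : ℕ) :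
    x ^ n ∈ p.symbolicPow (j * n) := by
  induction n with
  | zero => simp [symbolicPow_zero]
  | succ n ih => rw [pow_succ, Nat.mul_succ]; exact mul_mem_symbolicPow ih hx

/-- Symbolic powers of `p` are `p`-primary. -/
theorem mem_symbolicPow_of_mul_mem {k : ℕ} {u x : R} (hu : u ∉ p)
    (h : u * x ∈ p.symbolicPow k) : x ∈ p.symbolicPow k := by
  obtain ⟨v, hv, hvx⟩ := mem_symbolicPow.mp h
  exact mem_symbolicPow.mpr ⟨v * u, p.primeCompl.mul_mem hv hu, by rwa [mul_assoc]⟩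

theorem pow_le_symbolicPow_of_le {I : Ideal R} {k : ℕ} (h : I ≤ p.symbolicPow k) (n : ℕ) :
    I ^ n ≤ p.symbolicPow (k * n) := by
  induction n with
  | zero => simp [symbolicPow_zero]
  | succ n ih =>
    rw [pow_succ, Nat.mul_succ, mul_le]
    exact fun x hx y hy => mul_mem_symbolicPow (ih hx) (h hy)

end SymbolicPow

/-! ### Local uniformizers -/

section Uniformizer

variable {R : Type*} [CommRing R] {p : Ideal R}

/-- `t` generates the prime `p` locally at `p`, and is nonzero: a single `c ∉ p` satisfies
`c p ⊆ t R`. Over a Noetherian domain this says that `R_p` is a discrete valuation ring with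
uniformizer `t`; the form chosen here does not mention the localization. -/
def IsLocalUniformizer (p : Ideal R) (t : R) : Prop :=
  t ∈ p ∧ t ≠ 0 ∧ ∃ c ∉ p, ∀ y ∈ p, t ∣ c * y

/-- If `p = (b : x)` with `R` integrally closed, then `p x ⊄ b p`: otherwise `x / b` would
stabilize the finitely generated module `p`, hence be integral over `R`, and `b` would divide `x`.
So `t x = b c` for some `t ∈ p` and `c ∉ p`, and then `c y ∈ t R` for all `y ∈ p`. -/
theorem exists_isLocalUniformizer [IsDomain R] [IsNoetherianRing R] [IsIntegrallyClosed R]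
    [hp : p.IsPrime] {b x : R} (hb : b ≠ 0) (hpx : ∀ y, y ∈ p ↔ b ∣ y * x) :
    ∃ t, IsLocalUniformizer p t := by
  by_cases h : ∀ t ∈ p, ∀ c, t * x = b * c → c ∈ p
  · exfalso
    let K := FractionRing R
    have hbK : algebraMap R K b ≠ 0 := by simpa using hb
    have hbp : b ∈ p := (hpx b).mpr (dvd_mul_right _ _)
    let N : Submodule R K := Submodule.map (Algebra.linearMap R K) p
    have hint : IsIntegral R (algebraMap R K x / algebraMap R K b) := by
      refine isIntegral_of_smul_mem_submodule N ?_ ?_ _ ?_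
      · intro h0
        have : algebraMap R K b ∈ N := ⟨b, hbp, rfl⟩
        rw [h0, Submodule.mem_bot] at this
        exact hbK this
      · exact Submodule.FG.map _ (IsNoetherian.noetherian p)
      · rintro _ ⟨y, hy, rfl⟩
        obtain ⟨c, hc⟩ := (hpx y).mp hy
        refine ⟨c, h y hy c hc, ?_⟩
        rw [Algebra.linearMap_apply, Algebra.linearMap_apply, smul_eq_mul, div_mul_eq_mul_div,
          eq_div_iff hbK, ← map_mul, ← map_mul, mul_comm x, hc, mul_comm]
    obtain ⟨z, hz⟩ := IsIntegrallyClosed.isIntegral_iff.mp hint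
    rw [eq_div_iff hbK, ← map_mul] at hz
    have hz' := IsFractionRing.injective R K hz
    refine hp.ne_top ((eq_top_iff_one _).mpr ((hpx 1).mpr ⟨z, ?_⟩))
    rw [one_mul, ← hz', mul_comm]
  · push Not at h
    obtain ⟨t, ht, c, htc, hc⟩ := h
    refine ⟨t, ht, ?_, c, hc, fun y hy => ?_⟩
    · rintro rfl
      rw [zero_mul, eq_comm, mul_eq_zero] at htc
      exact hc ((htc.resolve_left hb) ▸ p.zero_mem)
    · obtain ⟨d, hd⟩ := (hpx y).mp hy
      refine ⟨d, mul_left_cancel₀ hb ?_⟩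
      linear_combination (-y) * htc + t * hd

variable [hp : p.IsPrime] {t : R}

namespace IsLocalUniformizer

theorem mem_symbolicPow_iff (ht : IsLocalUniformizer p t) {k : ℕ} {x : R} :
    x ∈ p.symbolicPow k ↔ ∃ u ∉ p, t ^ k ∣ u * x := by
  obtain ⟨htp, -, c, hc, hct⟩ := ht
  constructor
  · intro h
    obtain ⟨u, hu, hux⟩ := mem_symbolicPow.mp h
    have hle : span {c} * p ≤ span {t} := by
      rw [span_singleton_mul_le_iff]
      exact fun y hy => mem_span_singleton.mpr (hct y hy)
    have hk := pow_right_mono hle k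
    rw [mul_pow, span_singleton_pow, span_singleton_pow, span_singleton_mul_le_iff] at hk
    refine ⟨c ^ k * u, p.primeCompl.mul_mem (p.primeCompl.pow_mem hc k) hu, ?_⟩
    rw [mul_assoc]
    exact mem_span_singleton.mp (hk _ hux)
  · rintro ⟨u, hu, d, hd⟩
    exact mem_symbolicPow.mpr ⟨u, hu, hd ▸ mul_mem_right _ _ (pow_mem_pow htp k)⟩

variable [IsDomain R]

/-- Symbolic powers behave like the filtration of a valuation: if `x` has order exactly `j`
at `p` and `x y` has order at least `j + k`, then `y` has order at least `k`. -/
theorem mem_of_mul_mem (ht : IsLocalUniformizer p t) {j k : ℕ} {x y : R}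
    (hx : x ∈ p.symbolicPow j) (hx' : x ∉ p.symbolicPow (j + 1))
    (hxy : x * y ∈ p.symbolicPow (j + k)) : y ∈ p.symbolicPow k := by
  obtain ⟨u, hu, w, hw⟩ := ht.mem_symbolicPow_iff.mp hx
  obtain ⟨v, hv, z, hz⟩ := ht.mem_symbolicPow_iff.mp hxy
  obtain ⟨-, ht0, c, hc, hct⟩ := id ht
  have hwp : w ∉ p := by
    intro hwp
    obtain ⟨d, hd⟩ := hct w hwp
    refine hx' (ht.mem_symbolicPow_iff.mpr ⟨c * u, p.primeCompl.mul_mem hc hu, d, ?_⟩)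
    linear_combination c * hw + t ^ j * hd
  refine ht.mem_symbolicPow_iff.mpr
    ⟨w * v, p.primeCompl.mul_mem hwp hv, u * z, mul_left_cancel₀ (pow_ne_zero j ht0) ?_⟩
  linear_combination (-(v * y)) * hw + u * hz

theorem pow_notMem (ht : IsLocalUniformizer p t) {j : ℕ} {x : R}
    (hx : x ∈ p.symbolicPow j) (hx' : x ∉ p.symbolicPow (j + 1)) (n : ℕ) :
    x ^ n ∉ p.symbolicPow (j * n + 1) := by
  induction n with
  | zero => simpa [symbolicPow_one] using one_notMem p
  | succ n ih =>
    intro h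
    refine ih (ht.mem_of_mul_mem hx hx' ?_)
    rwa [← pow_succ', ← add_assoc, add_comm j, ← Nat.mul_succ]

theorem notMem_symbolicPow_two (ht : IsLocalUniformizer p t) : t ∉ p.symbolicPow 2 := by
  intro h
  obtain ⟨u, hu, z, hz⟩ := ht.mem_symbolicPow_iff.mp h
  have : u = t * z := mul_right_cancel₀ ht.2.1 (by linear_combination hz)
  exact hu (this ▸ mul_mem_right _ _ ht.1)

/-- Symbolic powers of `p` are integrally closed ideals. -/
theorem intClosure_le (ht : IsLocalUniformizer p t) {I : Ideal R} {k : ℕ}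
    (hI : I ≤ p.symbolicPow k) : I.intClosure ≤ p.symbolicPow k := by
  rintro x ⟨n, hn, a, ha, h⟩
  by_contra hx
  classical
  -- `j` is the order of `x` at `p`
  have hex : ∃ j, x ∉ p.symbolicPow (j + 1) := ⟨k, fun h => hx (symbolicPow_anti (by omega) h)⟩
  set j := Nat.find hex with hj
  have hxj' : x ∉ p.symbolicPow (j + 1) := Nat.find_spec hex
  have hxj : x ∈ p.symbolicPow j := by
    rcases hj' : j with _ | i
    · simp [symbolicPow_zero]
    · exact not_not.mp (Nat.find_min hex (m := i) (by omega))
  have hjk : j < k := by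
    by_contra hle
    exact hx (symbolicPow_anti (not_lt.mp hle) hxj)
  refine ht.pow_notMem hxj hxj' n ?_
  rw [eq_neg_of_add_eq_zero_left h]
  refine neg_mem (sum_mem _ fun i hi => ?_)
  obtain ⟨hi1, hin⟩ := Finset.mem_Icc.mp hi
  refine symbolicPow_anti ?_
    (mul_mem_symbolicPow (pow_le_symbolicPow_of_le hI i (ha i hi)) (pow_mem_symbolicPow hxj (n - i)))
  obtain ⟨l, rfl⟩ := Nat.exists_eq_add_of_le hin
  rw [Nat.add_sub_cancel_left]
  nlinarith

theorem height_eq_one [IsNoetherianRing R] (ht : IsLocalUniformizer p t) : p.height = 1 := by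
  obtain ⟨htp, ht0, c, hc, hct⟩ := ht
  have hmin : p ∈ (span {t}).minimalPrimes := by
    refine ⟨⟨hp, (span_singleton_le_iff_mem _).mpr htp⟩, fun q ⟨hq, htq⟩ hqp y hy => ?_⟩
    have : c * y ∈ q := htq (mem_span_singleton.mpr (hct y hy))
    exact (hq.mem_or_mem this).resolve_left fun h => hc (hqp h)
  refine le_antisymm (height_le_one_of_isPrincipal_of_mem_minimalPrimes (span {t}) p hmin) ?_
  rw [Order.one_le_iff_ne_zero, Ne, height_eq_zero_iff, IsDomain.minimalPrimes_eq_singleton_bot,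
    Set.mem_singleton_iff]
  rintro rfl
  exact ht0 htp

end IsLocalUniformizer

end Uniformizer

/-! ### Integral closures of ideals -/

section IntClosure

variable {R : Type*} [CommRing R]

theorem mem_intClosure_of_pow_mem {I : Ideal R} {x : R} {n : ℕ} (hn : 0 < n) (h : x ^ n ∈ I ^ n) :
    x ∈ I.intClosure := by
  classical
  refine ⟨n, hn, fun i => if i = n then -x ^ n else 0, fun i _ => ?_, ?_⟩
  · dsimp only
    split_ifs with hi
    · rw [hi]
      exact neg_mem h
    · exact zero_mem _
  · rw [Finset.sum_eq_single_of_mem n (Finset.mem_Icc.mpr ⟨hn, le_rfl⟩) (by simp +contextual)]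
    simp

theorem le_intClosure (I : Ideal R) : I ≤ I.intClosure := fun x hx =>
  mem_intClosure_of_pow_mem one_pos (by simpa using hx)

theorem exists_eq_span_singleton_mul {I : Ideal R} {c : R} (hI : I ≤ span {c}) :
    ∃ L : Ideal R, I = span {c} * L := by
  refine ⟨I.colon {c}, le_antisymm (le_span_singleton_mul_iff.mpr fun x hx => ?_)
    (span_singleton_mul_le_iff.mpr fun l hl => ?_)⟩
  · obtain ⟨l, rfl⟩ := mem_span_singleton.mp (hI hx)
    exact ⟨l, Submodule.mem_colon_singleton.mpr (by rwa [smul_eq_mul, mul_comm]), rfl⟩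
  · rw [mul_comm]
    exact Submodule.mem_colon_singleton.mp hl

/-- An equation of integral dependence over `c L`, with the powers of `c` split off. -/
theorem exists_of_mem_intClosure_span_singleton_mul {L : Ideal R} {c x : R}
    (hx : x ∈ (span {c} * L).intClosure) :
    ∃ n : ℕ, 0 < n ∧ ∃ l : ℕ → R, (∀ i ∈ Finset.Icc 1 n, l i ∈ L ^ i) ∧
      x ^ n + ∑ i ∈ Finset.Icc 1 n, c ^ i * l i * x ^ (n - i) = 0 := by
  obtain ⟨n, hn, a, ha, h⟩ := hx
  have : ∀ i, ∃ l, i ∈ Finset.Icc 1 n → l ∈ L ^ i ∧ c ^ i * l = a i := by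
    intro i
    by_cases hi : i ∈ Finset.Icc 1 n
    · have := ha i hi
      rw [mul_pow, span_singleton_pow, mem_span_singleton_mul] at this
      exact this.imp fun l hl _ => hl
    · exact ⟨0, fun h => absurd h hi⟩
  choose l hl using this
  refine ⟨n, hn, l, fun i hi => (hl i hi).1, ?_⟩
  rw [← h]
  congr 1
  exact Finset.sum_congr rfl fun i hi => by rw [(hl i hi).2]

variable [IsDomain R]

/-- A nonzero principal ideal has no proper reduction: if `c` is integral over `I = c L`, dividing
an equation of integral dependence of degree `n` by `c ^ n` gives `1 ∈ L`. -/
theorem eq_span_singleton_of_mem_intClosure {I : Ideal R} {c : R} (hc : c ≠ 0)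
    (hI : I ≤ span {c}) (hcI : c ∈ I.intClosure) : I = span {c} := by
  obtain ⟨L, rfl⟩ := exists_eq_span_singleton_mul hI
  obtain ⟨n, hn, l, hl, h⟩ := exists_of_mem_intClosure_span_singleton_mul hcI
  have h1 : 1 + ∑ i ∈ Finset.Icc 1 n, l i = 0 := by
    refine mul_left_cancel₀ (pow_ne_zero n hc) ?_
    rw [mul_zero, ← h, mul_add, mul_one, Finset.mul_sum]
    congr 1
    refine Finset.sum_congr rfl fun i hi => ?_
    rw [mul_right_comm, ← pow_add, Nat.add_sub_cancel' (Finset.mem_Icc.mp hi).2]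
  have : L = ⊤ := by
    rw [eq_top_iff_one, eq_neg_of_add_eq_zero_left h1]
    refine neg_mem (sum_mem _ fun i hi => ?_)
    exact pow_le_self (by have := (Finset.mem_Icc.mp hi).1; omega) (hl i hi)
  rw [this, mul_top]

/-- Principal ideals of an integrally closed domain are integrally closed. -/
theorem intClosure_span_singleton [IsIntegrallyClosed R] {c : R} (hc : c ≠ 0) :
    (span {c}).intClosure = span {c} := by
  refine le_antisymm (fun x hx => ?_) (le_intClosure _)
  rw [← mul_top (span {c})] at hx
  obtain ⟨n, hn, l, -, h⟩ := exists_of_mem_intClosure_span_singleton_mul hx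
  let K := FractionRing R
  have hcK : algebraMap R K c ≠ 0 := by simpa using hc
  have hint : IsIntegral R (algebraMap R K x / algebraMap R K c) := by
    refine ⟨X ^ n + ∑ i ∈ Finset.Icc 1 n, C (l i) * X ^ (n - i), ?_, ?_⟩
    · apply monic_X_pow_add
      refine (degree_sum_le _ _).trans_lt ?_
      refine (Finset.sup_lt_iff (WithBot.bot_lt_coe n)).mpr fun i hi => ?_
      refine (degree_C_mul_X_pow_le _ _).trans_lt ?_
      rw [Finset.mem_Icc] at hi
      exact WithBot.coe_lt_coe.mpr (by omega : n - i < n)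
    · refine mul_left_cancel₀ (pow_ne_zero n hcK) ?_
      have h' := congrArg (algebraMap R K) h
      simp only [map_add, map_sum, map_mul, map_pow, map_zero] at h'
      simp only [eval₂_add, eval₂_X_pow, eval₂_finsetSum, eval₂_mul, eval₂_C]
      rw [mul_zero, ← h', mul_add, Finset.mul_sum, ← mul_pow, mul_div_cancel₀ _ hcK]
      congr 1
      refine Finset.sum_congr rfl fun i hi => ?_
      obtain ⟨j, rfl⟩ := Nat.exists_eq_add_of_le (Finset.mem_Icc.mp hi).2
      rw [Nat.add_sub_cancel_left, pow_add, mul_mul_mul_comm, ← mul_pow, mul_div_cancel₀ _ hcK]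
  obtain ⟨z, hz⟩ := IsIntegrallyClosed.isIntegral_iff.mp hint
  rw [eq_div_iff hcK, ← map_mul] at hz
  rw [mem_span_singleton']
  exact ⟨z, IsFractionRing.injective R K hz⟩

theorem isInvertible_of_pow_eq_span_singleton {J : Ideal R} {c : R} (hc : c ≠ 0) {k : ℕ}
    (hk : 0 < k) (hJ : J ^ k = span {c}) : J.IsInvertible := by
  have hcK : algebraMap R (FractionRing R) c ≠ 0 := by simpa using hc
  have h : IsUnit ((J ^ k : Ideal R) : FractionalIdeal R⁰ (FractionRing R)) := by
    rw [hJ, FractionalIdeal.coeIdeal_span_singleton]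
    exact .of_mul_eq_one _ (FractionalIdeal.spanSingleton_mul_inv _ hcK)
  rw [FractionalIdeal.coeIdeal_pow] at h
  exact (isUnit_pow_iff hk.ne').mp h

end IntClosure

/-! ### Associated primes of quotient rings -/

section AssociatedPrimes

variable {R : Type*} [CommRing R]

theorem mem_associatedPrimes_quotient_iff [IsNoetherianRing R] {I P : Ideal R} :
    P ∈ associatedPrimes R (R ⧸ I) ↔ P.IsPrime ∧ ∃ x, ∀ y, y ∈ P ↔ y * x ∈ I := by
  rw [AssociatedPrimes.mem_iff, isAssociatedPrime_iff]
  refine and_congr_right fun _ => ?_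
  rw [(Ideal.Quotient.mk_surjective (I := I)).exists]
  refine exists_congr fun x => SetLike.ext_iff.trans (forall_congr' fun y => ?_)
  rw [Submodule.mem_colon_singleton, Submodule.mem_bot, ← Ideal.Quotient.mk_eq_mk,
    ← Submodule.Quotient.mk_smul, Ideal.Quotient.mk_eq_mk, Ideal.Quotient.eq_zero_iff_mem,
    smul_eq_mul]

theorem exists_associatedPrime_of_notMem [IsNoetherianRing R] {I : Ideal R} {x : R} (hx : x ∉ I) :
    ∃ P ∈ associatedPrimes R (R ⧸ I), ∀ y, y * x ∈ I → y ∈ P := by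
  obtain ⟨P, hP, h⟩ := exists_le_isAssociatedPrime_of_isNoetherianRing R
    (Ideal.Quotient.mk I x) (mt Ideal.Quotient.eq_zero_iff_mem.mp hx)
  refine ⟨P, hP, fun y hy => h ?_⟩
  rw [Submodule.mem_colon_singleton, Submodule.mem_bot, ← Ideal.Quotient.mk_eq_mk,
    ← Submodule.Quotient.mk_smul, Ideal.Quotient.mk_eq_mk, Ideal.Quotient.eq_zero_iff_mem,
    smul_eq_mul]
  exact hy

end AssociatedPrimes

/-! ### Finite intersections of incomparable primes -/

section Family

variable {R ι : Type*} [CommRing R] {p : ι → Ideal R} [hp : ∀ i, (p i).IsPrime]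

theorem iInf_pow_le_iInf_symbolicPow (k : ℕ) : (⨅ i, p i) ^ k ≤ ⨅ i, (p i).symbolicPow k :=
  le_iInf fun i => (pow_right_mono (iInf_le _ i) k).trans (pow_le_symbolicPow k)

variable [Finite ι]

theorem exists_notMem_forall_mem (hinc : ∀ i j, p i ≤ p j → i = j) (i : ι) :
    ∃ e ∉ p i, ∀ j ≠ i, e ∈ p j := by
  classical
  have := Fintype.ofFinite ι
  have : ¬ (Finset.univ.erase i).inf p ≤ p i := by
    rw [(hp i).inf_le']
    rintro ⟨j, hj, hji⟩
    exact Finset.ne_of_mem_erase hj (hinc j i hji)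
  obtain ⟨e, he, hei⟩ := SetLike.not_le_iff_exists.mp this
  exact ⟨e, hei, fun j hj =>
    Finset.inf_le (f := p) (Finset.mem_erase.mpr ⟨hj, Finset.mem_univ j⟩) he⟩

/-- Locally at `p i` the ideal `(⨅ i, p i) ^ k` is `p i ^ k`. -/
theorem exists_notMem_mul_mem_iInf_pow (hinc : ∀ i j, p i ≤ p j → i = j) {i : ι} {k : ℕ} {x : R}
    (hx : x ∈ (p i).symbolicPow k) : ∃ u ∉ p i, u * x ∈ (⨅ i, p i) ^ k := by
  obtain ⟨e, he, hej⟩ := exists_notMem_forall_mem hinc i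
  obtain ⟨u, hu, hux⟩ := mem_symbolicPow.mp hx
  refine ⟨e ^ k * u, (p i).primeCompl.mul_mem ((p i).primeCompl.pow_mem he k) hu, ?_⟩
  have hle : span {e} * p i ≤ ⨅ i, p i := by
    refine span_singleton_mul_le_iff.mpr fun y hy => mem_iInf.mpr fun j => ?_
    by_cases hj : j = i
    · exact hj ▸ mul_mem_left _ _ hy
    · exact mul_mem_right _ _ (hej j hj)
  refine pow_right_mono hle k ?_
  rw [mul_pow, mul_assoc]
  exact mul_mem_mul (pow_mem_pow (mem_span_singleton_self e) k) hux

/-- If `x` lies in every `p i ^ (k)`, then `(J ^ k : x)`, with `J = ⨅ i, p i`, is contained in no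
`p i`, so by prime avoidance it meets the complement of their union. -/
theorem contractLocalization_iInf_pow (hinc : ∀ i j, p i ≤ p j → i = j) (k : ℕ) :
    ((⨅ i, p i) ^ k).contractLocalization (⨅ i, (p i).primeCompl) =
      ⨅ i, (p i).symbolicPow k := by
  have := Fintype.ofFinite ι
  ext x
  rw [mem_contractLocalization, mem_iInf]
  constructor
  · rintro ⟨u, hu, hux⟩ i
    exact mem_symbolicPow_of_mul_mem (Submonoid.mem_iInf.mp hu i)
      (mem_iInf.mp (iInf_pow_le_iInf_symbolicPow k hux) i)
  · intro hx
    by_contra! hcon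
    have hsub : (((⨅ i, p i) ^ k).colon {x} : Set R) ⊆
        ⋃ i ∈ ((Finset.univ : Finset ι) : Set ι), p i := by
      intro u hu
      by_contra hup
      refine hcon u (Submonoid.mem_iInf.mpr fun i hui => hup ?_)
        (Submodule.mem_colon_singleton.mp hu)
      simp only [Set.mem_iUnion]
      exact ⟨i, Finset.mem_coe.mpr (Finset.mem_univ i), hui⟩
    rcases isEmpty_or_nonempty ι with hι | ⟨⟨i₀⟩⟩
    · exact absurd (hsub (zero_mem (((⨅ i, p i) ^ k).colon {x}))) (by simp)
    · obtain ⟨i, -, hi⟩ := (subset_union_prime i₀ i₀ fun i _ _ _ => hp i).mp hsub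
      obtain ⟨u, hu, hux⟩ := exists_notMem_mul_mem_iInf_pow hinc (hx i)
      exact hu (hi (Submodule.mem_colon_singleton.mpr hux))

theorem associatedPrimes_iInf_symbolicPow_subset [IsNoetherianRing R] (k : ℕ) :
    associatedPrimes R (R ⧸ ⨅ i, (p i).symbolicPow k) ⊆ Set.range p := by
  intro P hP
  have := Fintype.ofFinite ι
  obtain ⟨hPp, x, hx⟩ := mem_associatedPrimes_quotient_iff.mp hP
  have hle : Finset.univ.inf (fun i => ((p i).symbolicPow k).colon {x}) ≤ P := by
    intro y hy
    refine (hx y).mpr (mem_iInf.mpr fun i => ?_)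
    exact Submodule.mem_colon_singleton.mp
      (Finset.inf_le (f := fun i => ((p i).symbolicPow k).colon {x}) (Finset.mem_univ i) hy)
  obtain ⟨i, -, hi⟩ := hPp.inf_le'.mp hle
  have hi' : ∀ y, y * x ∈ (p i).symbolicPow k → y ∈ P := fun y hy =>
    hi (Submodule.mem_colon_singleton.mpr hy)
  refine ⟨i, le_antisymm ?_ fun y hy => ?_⟩
  · -- `p i ^ k ≤ (p i ^ (k) : x) ≤ P`
    exact hPp.le_of_pow_le (n := k) fun y hy =>
      hi' y (mul_mem_right _ _ (pow_le_symbolicPow k hy))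
  · by_contra hyi
    have hxi := mem_symbolicPow_of_mul_mem hyi (mem_iInf.mp ((hx y).mp hy) i)
    exact hPp.ne_top ((eq_top_iff_one _).mpr (hi' 1 (by rwa [one_mul])))

theorem mem_associatedPrimes_iInf [IsNoetherianRing R] (hinc : ∀ i j, p i ≤ p j → i = j) (i : ι) :
    p i ∈ associatedPrimes R (R ⧸ ⨅ i, p i) := by
  obtain ⟨e, he, hej⟩ := exists_notMem_forall_mem hinc i
  refine mem_associatedPrimes_quotient_iff.mpr ⟨hp i, e, fun y => ⟨fun hy => ?_, fun hy => ?_⟩⟩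
  · refine mem_iInf.mpr fun j => ?_
    by_cases hj : j = i
    · exact hj ▸ mul_mem_right _ _ hy
    · exact mul_mem_left _ _ (hej j hj)
  · exact ((hp i).mem_or_mem (mem_iInf.mp hy i)).resolve_right he

variable [IsDomain R]

omit [Finite ι] in
theorem intClosure_iInf_pow_le (ht : ∀ i, ∃ t, IsLocalUniformizer (p i) t) (k : ℕ) :
    ((⨅ i, p i) ^ k).intClosure ≤ ⨅ i, (p i).symbolicPow k :=
  le_iInf fun i =>
    (ht i).choose_spec.intClosure_le ((iInf_pow_le_iInf_symbolicPow k).trans (iInf_le _ i))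

omit [Finite ι] in
theorem intClosure_iInf (ht : ∀ i, ∃ t, IsLocalUniformizer (p i) t) :
    (⨅ i, p i).intClosure = ⨅ i, p i := by
  refine le_antisymm ?_ (le_intClosure _)
  simpa only [pow_one, symbolicPow_one] using intClosure_iInf_pow_le ht 1

/-- Some element of the intersection has order exactly one at `p i`. -/
theorem exists_mem_iInf_notMem_symbolicPow_two (ht : ∀ i, ∃ t, IsLocalUniformizer (p i) t)
    (hinc : ∀ i j, p i ≤ p j → i = j) (i : ι) : ∃ x ∈ ⨅ i, p i, x ∉ (p i).symbolicPow 2 := by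
  obtain ⟨t, ht⟩ := ht i
  obtain ⟨e, he, hej⟩ := exists_notMem_forall_mem hinc i
  refine ⟨e * t, mem_iInf.mpr fun j => ?_,
    fun h => ht.notMem_symbolicPow_two (mem_symbolicPow_of_mul_mem he h)⟩
  by_cases hj : j = i
  · exact hj ▸ mul_mem_left _ _ ht.1
  · exact mul_mem_right _ _ (hej j hj)

/-- All asymptotic primes of `J = ⨅ i, p i` are among the `p i` exactly when the integral closure
of each `J ^ k` is the intersection of the symbolic powers: an element of the latter outside
`(J ^ k)_a` would have its conductor into `(J ^ k)_a` inside some `p i`, but locally at `p i` the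
two ideals agree. -/
theorem asymptoticPrimes_iInf_eq_range_iff [IsNoetherianRing R]
    (ht : ∀ i, ∃ t, IsLocalUniformizer (p i) t) (hinc : ∀ i j, p i ≤ p j → i = j) :
    (⨅ i, p i).asymptoticPrimes = Set.range p ↔
      ∀ k : ℕ, 0 < k → ((⨅ i, p i) ^ k).intClosure = ⨅ i, (p i).symbolicPow k := by
  constructor
  · intro h k hk
    refine le_antisymm (intClosure_iInf_pow_le ht k) fun x hx => ?_
    by_contra hx'
    obtain ⟨P, hP, hxP⟩ := exists_associatedPrime_of_notMem hx'
    obtain ⟨i, rfl⟩ := h.subset ⟨k, hk, hP⟩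
    obtain ⟨u, hu, hux⟩ := exists_notMem_mul_mem_iInf_pow hinc (mem_iInf.mp hx i)
    exact hu (hxP u (le_intClosure _ hux))
  · intro h
    refine Set.Subset.antisymm ?_ ?_
    · rintro P ⟨k, hk, hP⟩
      rw [h k hk] at hP
      exact associatedPrimes_iInf_symbolicPow_subset k hP
    · rintro _ ⟨i, rfl⟩
      refine ⟨1, one_pos, ?_⟩
      rw [pow_one, intClosure_iInf ht]
      exact mem_associatedPrimes_iInf hinc i

/-! ### Powers of a principal intersection of symbolic powers -/

variable {m : ℕ} {b : R}

theorem notMem_symbolicPow_succ_of_span_eq (ht : ∀ i, ∃ t, IsLocalUniformizer (p i) t)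
    (hinc : ∀ i j, p i ≤ p j → i = j) (hbm : span {b} = ⨅ i, (p i).symbolicPow m) (i : ι) :
    b ∉ (p i).symbolicPow (m + 1) := by
  obtain ⟨x, hx, hx2⟩ := exists_mem_iInf_notMem_symbolicPow_two ht hinc i
  have hxb : x ^ m ∈ span {b} := hbm ▸ iInf_pow_le_iInf_symbolicPow m (pow_mem_pow hx m)
  obtain ⟨y, hy⟩ := mem_span_singleton.mp hxb
  intro hb
  have hx1 : x ∈ (p i).symbolicPow 1 := by
    rw [symbolicPow_one]
    exact mem_iInf.mp hx i
  refine (ht i).choose_spec.pow_notMem hx1 hx2 m ?_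
  rw [one_mul, hy]
  exact mul_mem_right _ _ hb

theorem iInf_symbolicPow_mul_le_span_pow (ht : ∀ i, ∃ t, IsLocalUniformizer (p i) t)
    (hinc : ∀ i j, p i ≤ p j → i = j) (hbm : span {b} = ⨅ i, (p i).symbolicPow m) (k : ℕ) :
    ⨅ i, (p i).symbolicPow (m * k) ≤ span {b ^ k} := by
  induction k with
  | zero => simp
  | succ k ih =>
    intro x hx
    rw [mem_iInf] at hx
    have hxb : x ∈ span {b} := hbm ▸ mem_iInf.mpr fun i =>
      symbolicPow_anti (Nat.le_mul_of_pos_right m k.succ_pos) (hx i)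
    obtain ⟨y, rfl⟩ := mem_span_singleton.mp hxb
    have hb : ∀ i, b ∈ (p i).symbolicPow m := mem_iInf.mp (hbm ▸ mem_span_singleton_self b)
    have hy : y ∈ span {b ^ k} := ih <| mem_iInf.mpr fun i =>
      (ht i).choose_spec.mem_of_mul_mem (hb i) (notMem_symbolicPow_succ_of_span_eq ht hinc hbm i)
        (by rw [add_comm, ← Nat.mul_succ]; exact hx i)
    rw [pow_succ']
    exact mem_span_singleton.mpr (mul_dvd_mul_left b (mem_span_singleton.mp hy))

/-- Write `J ^ m = b L`, where `J = ⨅ i, p i`. No `p i` contains `L`, and `L` contains a power of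
`b`; so if `L` is invertible, every element of `L⁻¹` lies in `R`, and `L = R`. -/
theorem IsInvertible.iInf_pow_eq_span (ht : ∀ i, ∃ t, IsLocalUniformizer (p i) t)
    (hinc : ∀ i j, p i ≤ p j → i = j) (hm : 0 < m) (hb0 : b ≠ 0)
    (hbm : span {b} = ⨅ i, (p i).symbolicPow m) (hJ : (⨅ i, p i).IsInvertible) :
    (⨅ i, p i) ^ m = span {b} := by
  obtain ⟨l, rfl⟩ := Nat.exists_eq_succ_of_ne_zero hm.ne'
  obtain ⟨L, hL⟩ := exists_eq_span_singleton_mul (hbm ▸ iInf_pow_le_iInf_symbolicPow (p := p) l.succ)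
  have hb : ∀ i, b ∈ (p i).symbolicPow l.succ := mem_iInf.mp (hbm ▸ mem_span_singleton_self b)
  have hbJ : b ∈ ⨅ i, p i := mem_iInf.mpr fun i => by
    simpa only [symbolicPow_one] using symbolicPow_anti hm (hb i)
  have hbL : b ^ l ∈ L := by
    have h := pow_mem_pow hbJ l.succ
    rw [hL, mem_span_singleton_mul] at h
    obtain ⟨z, hz, hbz⟩ := h
    rwa [← mul_left_cancel₀ hb0 (hbz.trans (pow_succ' b l))]
  have hLp : ∀ i, ∃ z ∈ L, z ∉ p i := by
    intro i
    obtain ⟨x, hx, hx2⟩ := exists_mem_iInf_notMem_symbolicPow_two ht hinc i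
    have h := pow_mem_pow hx l.succ
    rw [hL, mem_span_singleton_mul] at h
    obtain ⟨z, hz, hbz⟩ := h
    refine ⟨z, hz, fun hzp => (ht i).choose_spec.pow_notMem (j := 1) ?_ hx2 l.succ ?_⟩
    · rw [symbolicPow_one]
      exact mem_iInf.mp hx i
    · rw [← hbz, one_mul]
      exact mul_mem_symbolicPow (hb i) (by rwa [symbolicPow_one])
  let K := FractionRing R
  have hLu : IsUnit (L : FractionalIdeal R⁰ K) := by
    have h := hJ.pow l.succ
    rw [← FractionalIdeal.coeIdeal_pow, hL, FractionalIdeal.coeIdeal_mul] at h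
    exact isUnit_of_mul_isUnit_right h
  obtain ⟨K', hK'⟩ := hLu.exists_right_inv
  have hK1 : K' ≤ 1 := by
    intro z hz
    have hLz : ∀ y ∈ L, ∃ s, algebraMap R K s = algebraMap R K y * z := by
      intro y hy
      rw [← FractionalIdeal.mem_one_iff R⁰, ← hK']
      exact FractionalIdeal.mul_mem_mul (FractionalIdeal.mem_coeIdeal_of_mem _ hy) hz
    obtain ⟨r, hr⟩ := hLz _ hbL
    have hrb : r ∈ span {b ^ l} := by
      refine iInf_symbolicPow_mul_le_span_pow ht hinc hbm l (mem_iInf.mpr fun i => ?_)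
      obtain ⟨y, hy, hyp⟩ := hLp i
      obtain ⟨s, hs⟩ := hLz y hy
      have hyr : y * r = b ^ l * s := by
        apply IsFractionRing.injective R K
        rw [map_mul, map_mul, hr, hs]
        ring
      refine mem_symbolicPow_of_mul_mem hyp (hyr ▸ mul_mem_right _ _ ?_)
      exact pow_mem_symbolicPow (hb i) l
    obtain ⟨s, rfl⟩ := mem_span_singleton.mp hrb
    rw [FractionalIdeal.mem_one_iff]
    refine ⟨s, mul_left_cancel₀ (a := algebraMap R K (b ^ l)) (by simp [hb0]) ?_⟩
    rw [← hr, map_mul]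
  have hL1 : (1 : FractionalIdeal R⁰ K) ≤ (L : FractionalIdeal R⁰ K) := by
    rw [← hK']
    exact mul_le_of_le_one_right' hK1
  rw [← FractionalIdeal.coeIdeal_top, FractionalIdeal.coeIdeal_le_coeIdeal, top_le_iff] at hL1
  rw [hL, hL1, mul_top]

/-- If `J ^ m = b R`, then an element `x` of every `p i ^ (k)` satisfies `x ^ m ∈ (J ^ k) ^ m`. -/
theorem intClosure_iInf_pow_of_pow_eq_span (ht : ∀ i, ∃ t, IsLocalUniformizer (p i) t)
    (hinc : ∀ i j, p i ≤ p j → i = j) (hm : 0 < m) (hbm : span {b} = ⨅ i, (p i).symbolicPow m)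
    (hJ : (⨅ i, p i) ^ m = span {b}) (k : ℕ) :
    ((⨅ i, p i) ^ k).intClosure = ⨅ i, (p i).symbolicPow k := by
  refine le_antisymm (intClosure_iInf_pow_le ht k) fun x hx => mem_intClosure_of_pow_mem hm ?_
  rw [pow_right_comm, hJ, span_singleton_pow]
  refine iInf_symbolicPow_mul_le_span_pow ht hinc hbm k (mem_iInf.mpr fun i => ?_)
  rw [mul_comm]
  exact pow_mem_symbolicPow (mem_iInf.mp hx i) m

end Family

end Ideal

/-! ### The equivalence -/

open Ideal in
theorem proposition3p5 {R : Type*} [CommRing R] [IsDomain R] [IsNoetherianRing R]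
    [IsIntegrallyClosed R] (m : ℕ) (hm : 0 < m) (b : R) (hb0 : b ≠ 0) (hbu : ¬ IsUnit b)
    (n : ℕ) (p : Fin n → Ideal R) [∀ i, (p i).IsPrime] (hpinj : Function.Injective p)
    (hp : Set.range p = associatedPrimes R (R ⧸ Ideal.span {b}))
    (J : Ideal R) (hJ : J = ⨅ i, p i)
    (hbm : Ideal.span {b} = ⨅ i, (p i).symbolicPow m) :
    (∀ i, (p i).height = 1) ∧ J = (Ideal.span {b}).radical ∧
    List.TFAE [
      J.IsProjectivelyEquivalent (Ideal.span {b}),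
      ∃ I : Ideal R, I.IsPrincipal ∧ J.IsProjectivelyEquivalent I,
      ∃ k : ℕ, 0 < k ∧ Ideal.span {b} = ((⨅ i, p i) ^ k).intClosure,
      ∃ k : ℕ, 0 < k ∧ ((J ^ k).intClosure).IsPrincipal,
      J.IsInvertible,
      ∀ k : ℕ, 0 < k → ((⨅ i, p i) ^ k).intClosure = ⨅ i, (p i).symbolicPow k,
      J.asymptoticPrimes = Set.range p,
      ∀ k : ℕ, 0 < k →
        (J ^ k).contractLocalization (⨅ i, (p i).primeCompl) = (J ^ k).intClosure] := by
  have ht : ∀ i, ∃ t, IsLocalUniformizer (p i) t := fun i => by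
    obtain ⟨-, x, hx⟩ := mem_associatedPrimes_quotient_iff.mp (hp.subset ⟨i, rfl⟩)
    exact exists_isLocalUniformizer hb0 fun y => (hx y).trans mem_span_singleton
  have hht : ∀ i, (p i).height = 1 := fun i => (ht i).choose_spec.height_eq_one
  have hinc : ∀ i j, p i ≤ p j → i = j := fun i j hij => by
    have hmem := mem_minimalPrimes_of_height_le hij ((hht j).trans (hht i).symm).le
    rw [minimalPrimes_eq_subsingleton_self, Set.mem_singleton_iff] at hmem
    exact hpinj hmem.symm
  have hb : ∀ i, b ∈ (p i).symbolicPow m := mem_iInf.mp (hbm ▸ mem_span_singleton_self b)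
  have hbJ : b ∈ J := hJ ▸ mem_iInf.mpr fun i => by
    simpa only [symbolicPow_one] using symbolicPow_anti hm (hb i)
  have hrad : J = (span {b}).radical := by
    apply le_antisymm
    · exact fun x hx => ⟨m, hbm ▸ iInf_pow_le_iInf_symbolicPow m (pow_mem_pow (hJ ▸ hx) m)⟩
    · rw [hJ]
      refine le_iInf fun i => (IsPrime.radical_le_iff inferInstance).mpr ?_
      exact (span_singleton_le_iff_mem _).mpr (mem_iInf.mp (hJ ▸ hbJ) i)
  have hbtop : span {b} ≠ ⊤ := mt span_singleton_eq_top.mp hbu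
  refine ⟨hht, hrad, ?_⟩
  have hinv : J.IsInvertible → J ^ m = span {b} := by
    rw [hJ]
    exact IsInvertible.iInf_pow_eq_span ht hinc hm hb0 hbm
  tfae_have 1 → 2 := fun h => ⟨_, ⟨b, rfl⟩, h⟩
  tfae_have 2 → 4 := by
    rintro ⟨_, ⟨c, rfl⟩, ⟨⟨x, hx, hx0⟩, -⟩, s, t, -, ht0, hst⟩
    have hc : c ≠ 0 := by
      rintro rfl
      obtain ⟨y, rfl⟩ := mem_span_singleton.mp hx
      exact nonZeroDivisors.ne_zero hx0 (zero_mul y)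
    refine ⟨t, ht0, c ^ s, ?_⟩
    rw [← hst, submodule_span_eq, span_singleton_pow, intClosure_span_singleton (pow_ne_zero s hc)]
  tfae_have 4 → 5 := by
    rintro ⟨k, hk, c, hc⟩
    rw [submodule_span_eq] at hc
    have hc0 : c ≠ 0 := by
      rintro rfl
      have : b ^ k ∈ span {(0 : R)} := hc ▸ le_intClosure _ (pow_mem_pow hbJ k)
      exact pow_ne_zero k hb0 (by simpa using this)
    exact isInvertible_of_pow_eq_span_singleton hc0 hk <| eq_span_singleton_of_mem_intClosure hc0
      (hc ▸ le_intClosure _) (hc ▸ mem_span_singleton_self c)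
  tfae_have 5 → 6 := fun h =>
    fun k _ => intClosure_iInf_pow_of_pow_eq_span ht hinc hm hbm (hJ ▸ hinv h) k
  tfae_have 6 → 3 := fun h => ⟨m, hm, by rw [h m hm, hbm]⟩
  tfae_have 3 → 1 := by
    rintro ⟨k, hk, h⟩
    refine ⟨⟨⟨b, mem_span_singleton_self b, mem_nonZeroDivisors_of_ne_zero hb0⟩, hbtop⟩,
      1, k, one_pos, hk, ?_⟩
    rw [pow_one, intClosure_span_singleton hb0, h, hJ]
  tfae_have 6 ↔ 7 := by
    rw [hJ]
    exact (asymptoticPrimes_iInf_eq_range_iff ht hinc).symm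
  tfae_have 6 ↔ 8 := by
    rw [hJ]
    refine forall₂_congr fun k _ => ?_
    rw [contractLocalization_iInf_pow hinc, eq_comm]
  tfae_finish
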